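/- Let $k$ be a field, $R$ a $k$-algebra (associative, unital), and $N$ a right $R$-module. A pp-definable subgroup of $N$ is the solution set in $N$ of a formula $\exists \bar y\,(x,\bar y)H=0$, where $x$ is a single variable, $\bar y$ is a finite tuple of variables and $H$ is a finite matrix over $R$; $N$ is $\Sigma$-pure-injective if it has no infinite strictly descending chain of pp-definable subgroups. Suppose that $N$ is indecomposable (nonzero, and not a direct sum of two nonzero submodules) and $\Sigma$-pure-injective. Let $S=\operatorname{End}_R(N)$ be its (local) endomorphism ring, acting on $N$ on the left, let $\mathfrak m$ be the maximal ideal of $S$ (its Jacobson radical), and suppose that the canonical map $k\to S/\mathfrak m$ is an isomorphism. Let $E(S/\mathfrak m)$ be the injective hull of the left $S$-module $S/\mathfrak m$. Regard the local dual $\operatorname{Hom}_S(N,E(S/\mathfrak m))$ and the $k$-dual $N^*=\operatorname{Hom}_k(N,k)$ as left $R$-modules through $(rf)(n)=f(nr)$. Then $$\operatorname{Hom}_S(N,E(S/\mathfrak m))\;\cong\;\operatorname{Hom}_k(N,k)$$ as left $R$-modules, and both modules are indecomposable. -/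

import Mathlib

universe u v w

/-- A positive primitive formula in one free variable `x` over the right modules of `R`:
`∃ y₁ … yₙ, ⋀ⱼ (x * rⱼ + ∑ᵢ yᵢ * sᵢⱼ = 0)`, that is, `∃ y, (x, y) H = 0` for a finite matrix `H`. -/
structure PPFormula (R : Type u) where
  /-- number of quantified variables -/
  vars : ℕ
  /-- number of equations -/
  eqs : ℕ
  /-- coefficients of the free variable -/
  coeff : Fin eqs → R
  /-- coefficients of the quantified variables -/
  coeffs : Fin vars → Fin eqs → R

/-- The pp-definable subgroup `φ(N)` of a right `R`-module `N`: the solution set of `φ` in `N`. -/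
def PPFormula.eval {R : Type u} [Ring R] (φ : PPFormula R) (N : Type w) [AddCommGroup N]
    [Module Rᵐᵒᵖ N] : AddSubgroup N where
  carrier := {x | ∃ y : Fin φ.vars → N, ∀ j : Fin φ.eqs,
    MulOpposite.op (φ.coeff j) • x + ∑ i, MulOpposite.op (φ.coeffs i j) • y i = 0}
  zero_mem' := ⟨0, fun j => by simp⟩
  add_mem' := by
    rintro a b ⟨y, hy⟩ ⟨z, hz⟩
    refine ⟨y + z, fun j => ?_⟩
    have h := congrArg₂ (· + ·) (hy j) (hz j)
    simp only [add_zero] at h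
    rw [← h]
    simp only [smul_add, Pi.add_apply, Finset.sum_add_distrib]
    abel
  neg_mem' := by
    rintro a ⟨y, hy⟩
    refine ⟨-y, fun j => ?_⟩
    have h := congrArg (fun t => -t) (hy j)
    simp only [neg_zero] at h
    rw [← h]
    simp only [smul_neg, Pi.neg_apply, Finset.sum_neg_distrib, neg_add]

/-- A right `R`-module is Σ-pure-injective if it has no infinite strictly descending chain of
pp-definable subgroups. -/
def IsSigmaPureInjective (R : Type u) [Ring R] (N : Type w) [AddCommGroup N]
    [Module Rᵐᵒᵖ N] : Prop :=
  ¬ ∃ φ : ℕ → PPFormula R, StrictAnti fun n => (φ n).eval N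

/-- A module is indecomposable if it is nonzero and not the direct sum of two nonzero submodules. -/
def IsIndecomposableModule (A : Type u) [Ring A] (M : Type w) [AddCommGroup M]
    [Module A M] : Prop :=
  Nontrivial M ∧ ∀ p q : Submodule A M, IsCompl p q → p = ⊥ ∨ q = ⊥

/-- `i : M → E` is an injective hull of the (left) `S`-module `M`: an embedding into an injective
module with essential image. -/
structure IsInjectiveHull {S : Type u} [Ring S] {M E : Type w} [AddCommGroup M] [Module S M]
    [AddCommGroup E] [Module S E] (i : M →ₗ[S] E) : Prop where
  embedding : Function.Injective i
  injective : Module.Injective S E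
  essential : ∀ q : Submodule S E, q ⊓ LinearMap.range i = ⊥ → q = ⊥

/-- Every module has an injective hull. -/
theorem exists_isInjectiveHull (S : Type w) [Ring S] (M : Type w) [AddCommGroup M] [Module S M] :
    ∃ (E : Type w) (_ : AddCommGroup E) (_ : Module S E) (i : M →ₗ[S] E), IsInjectiveHull i := by
  classical
  obtain ⟨I, _, _, hI, j, hj⟩ : ∃ (I : Type w) (_ : AddCommGroup I) (_ : Module S I)
      (_ : Module.Injective S I) (j : M →ₗ[S] I), Function.Injective j := by
    let X := ModuleCat.of S M
    have hI : CategoryTheory.Injective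
        (ModuleCat.of S (CategoryTheory.Injective.under X : ModuleCat S)) :=
      inferInstanceAs (CategoryTheory.Injective (CategoryTheory.Injective.under X))
    refine ⟨(CategoryTheory.Injective.under X : ModuleCat S), inferInstance, inferInstance,
      Module.injective_module_of_injective_object S _,
      (CategoryTheory.Injective.ι X).hom, ?_⟩
    exact (ModuleCat.mono_iff_injective _).1 inferInstance
  let P : Set (Submodule S I) :=
    {T | LinearMap.range j ≤ T ∧ ∀ q ≤ T, q ⊓ LinearMap.range j = ⊥ → q = ⊥}
  have hP0 : LinearMap.range j ∈ P :=
    ⟨le_rfl, fun q hq h => by rwa [inf_eq_left.2 hq] at h⟩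
  obtain ⟨T, hjT, hTmax⟩ : ∃ T, LinearMap.range j ≤ T ∧ Maximal (· ∈ P) T := by
    refine zorn_le_nonempty₀ P (fun c hcP hc y hy => ⟨sSup c, ⟨?_, ?_⟩, fun z hz => le_sSup hz⟩)
      _ hP0
    · exact (hcP hy).1.trans (le_sSup hy)
    · intro q hq h
      rw [Submodule.eq_bot_iff]
      intro x hx
      obtain ⟨t, ht, hxt⟩ := (Submodule.mem_sSup_of_directed ⟨y, hy⟩ hc.directedOn).1 (hq hx)
      have := (hcP ht).2 (Submodule.span S {x})
        (by rwa [Submodule.span_singleton_le_iff_mem])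
        (eq_bot_iff.2 (le_trans (inf_le_inf_right _
          ((Submodule.span_singleton_le_iff_mem _ _).2 hx)) h.le))
      exact (Submodule.span_singleton_eq_bot).1 this
  have hTP : T ∈ P := hTmax.prop
  obtain ⟨C, -, hCmax⟩ : ∃ C, (⊥ : Submodule S I) ≤ C ∧
      Maximal (· ∈ {C : Submodule S I | C ⊓ T = ⊥}) C := by
    refine zorn_le_nonempty₀ _ (fun c hcP hc y hy => ⟨sSup c, ?_, fun z hz => le_sSup hz⟩)
      _ (by simp)
    show sSup c ⊓ T = ⊥
    rw [Submodule.eq_bot_iff]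
    rintro x ⟨hx, hxT⟩
    obtain ⟨t, ht, hxt⟩ := (Submodule.mem_sSup_of_directed ⟨y, hy⟩ hc.directedOn).1 hx
    have h0 : t ⊓ T = ⊥ := hcP ht
    exact (Submodule.eq_bot_iff _).1 h0 x ⟨hxt, hxT⟩
  have hCT : C ⊓ T = ⊥ := hCmax.prop
  let f : T →ₗ[S] I ⧸ C := C.mkQ.comp T.subtype
  have hf : Function.Injective f := by
    rw [← LinearMap.ker_eq_bot, Submodule.eq_bot_iff]
    intro x hx
    have hxC : (x : I) ∈ C := by simpa [f] using hx
    exact Subtype.ext ((Submodule.eq_bot_iff _).1 hCT x ⟨hxC, x.2⟩)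
  obtain ⟨h, hh⟩ := hI.out f hf T.subtype
  -- every nonzero submodule of `I ⧸ C` meets the image of `T`
  have hker : ∀ q : Submodule S (I ⧸ C), q ⊓ LinearMap.range f = ⊥ → q = ⊥ := by
    intro q hq
    have h1 : q.comap C.mkQ ⊓ T = ⊥ := by
      rw [Submodule.eq_bot_iff]
      rintro x ⟨hx, hxT⟩
      have : C.mkQ x ∈ q ⊓ LinearMap.range f := ⟨hx, ⟨⟨x, hxT⟩, rfl⟩⟩
      rw [hq] at this
      have hxC : x ∈ C := by simpa using this
      exact (Submodule.eq_bot_iff _).1 hCT x ⟨hxC, hxT⟩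
    have h2 : q.comap C.mkQ ≤ C := hCmax.2 h1 (by
      intro x hx
      have : C.mkQ x = 0 := by simpa using hx
      simp [Submodule.mem_comap, this])
    rw [Submodule.eq_bot_iff]
    intro y hy
    obtain ⟨x, rfl⟩ := C.mkQ_surjective y
    simpa using h2 hy
  have hhinj : Function.Injective h := by
    rw [← LinearMap.ker_eq_bot]
    refine hker _ ?_
    rw [Submodule.eq_bot_iff]
    rintro _ ⟨hx, ⟨t, rfl⟩⟩
    have : h (f t) = 0 := hx
    rw [hh] at this
    have ht : t = 0 := Subtype.ext this
    simp [ht]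
  have hrange : LinearMap.range h ∈ P := by
    refine ⟨fun x hx => ⟨f ⟨x, hjT hx⟩, by simp [hh]⟩, fun q hq hqj => ?_⟩
    have hqT : q ⊓ T = ⊥ := hTP.2 _ inf_le_right (eq_bot_iff.2
      (le_trans (inf_le_inf_right _ inf_le_left) hqj.le))
    have h3 : q.comap h = ⊥ := by
      refine hker _ ?_
      rw [Submodule.eq_bot_iff]
      rintro _ ⟨hx, ⟨t, rfl⟩⟩
      have hx' : h (f t) ∈ q := hx
      rw [hh] at hx'
      have : (t : I) = 0 := (Submodule.eq_bot_iff _).1 hqT _ ⟨hx', t.2⟩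
      have ht : t = 0 := Subtype.ext this
      simp [ht]
    rw [Submodule.eq_bot_iff]
    intro x hx
    obtain ⟨y, rfl⟩ := hq hx
    have : y ∈ q.comap h := hx
    rw [h3] at this
    have hy : y = 0 := this
    simp [hy]
  have hTh : LinearMap.range h ≤ T := hTmax.2 hrange
    (fun x hx => ⟨f ⟨x, hx⟩, by simp [hh]⟩)
  -- `r` is a retraction of `I` onto `T`
  let r : I →ₗ[S] T := (h.codRestrict T fun y => hTh ⟨y, rfl⟩).comp C.mkQ
  have hr : ∀ t : T, r t = t := fun t => Subtype.ext (hh t)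
  refine ⟨T, inferInstance, inferInstance, j.codRestrict T fun x => hjT ⟨x, rfl⟩, ?_, ?_, ?_⟩
  · intro a b hab
    exact hj (congrArg Subtype.val hab)
  · refine ⟨fun X Y _ _ _ _ e he g => ?_⟩
    obtain ⟨g', hg'⟩ := hI.out e he (T.subtype.comp g)
    exact ⟨r.comp g', fun x => by
      rw [LinearMap.comp_apply, hg']
      exact hr (g x)⟩
  · intro q hq
    have h4 : q.map T.subtype = ⊥ := by
      refine hTP.2 _ (by rintro _ ⟨x, -, rfl⟩; exact x.2) ?_
      rw [Submodule.eq_bot_iff]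
      rintro _ ⟨⟨t, ht, rfl⟩, ⟨m, hm⟩⟩
      have : t ∈ q ⊓ LinearMap.range (j.codRestrict T fun x => hjT ⟨x, rfl⟩) :=
        ⟨ht, ⟨m, Subtype.ext hm⟩⟩
      rw [hq] at this
      have ht0 : t = 0 := this
      simp [ht0]
    rw [Submodule.eq_bot_iff]
    intro t ht
    exact Subtype.ext ((Submodule.eq_bot_iff _).1 h4 _ ⟨t, ht, rfl⟩)

section Hull

variable (S : Type w) [Ring S] (M : Type w) [AddCommGroup M] [Module S M]

/-- The injective hull `E(M)` of an `S`-module `M` (unique up to isomorphism over `M`). -/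
def InjectiveHull : Type w := (exists_isInjectiveHull S M).choose

noncomputable instance : AddCommGroup (InjectiveHull S M) :=
  (exists_isInjectiveHull S M).choose_spec.choose

noncomputable instance : Module S (InjectiveHull S M) :=
  (exists_isInjectiveHull S M).choose_spec.choose_spec.choose

/-- The inclusion of `M` into its injective hull. -/
noncomputable def InjectiveHull.incl : M →ₗ[S] InjectiveHull S M :=
  (exists_isInjectiveHull S M).choose_spec.choose_spec.choose_spec.choose

theorem InjectiveHull.isInjectiveHull : IsInjectiveHull (InjectiveHull.incl S M) :=
  (exists_isInjectiveHull S M).choose_spec.choose_spec.choose_spec.choose_spec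

end Hull

/-- For an `A`-`R`-bimodule `N` (left `A`-module, right `R`-module) and a left `A`-module `E`,
the group `Hom_A(N, E)`, regarded as a left `R`-module through `(r • f) n = f (n * r)`. -/
def HomDual (A : Type u) [Ring A] (N : Type v) [AddCommGroup N] [Module A N]
    (E : Type w) [AddCommGroup E] [Module A E] := N →ₗ[A] E

section HomDual

variable {A : Type*} [Ring A] {N : Type*} [AddCommGroup N] [Module A N]
  {E : Type*} [AddCommGroup E] [Module A E]

instance : AddCommGroup (HomDual A N E) := inferInstanceAs (AddCommGroup (N →ₗ[A] E))

instance : FunLike (HomDual A N E) N E := inferInstanceAs (FunLike (N →ₗ[A] E) N E)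

instance {R : Type*} [Ring R] [Module Rᵐᵒᵖ N] [SMulCommClass A Rᵐᵒᵖ N] :
    Module R (HomDual A N E) where
  smul r f := LinearMap.mk ⟨fun n => f (MulOpposite.op r • n), fun a b => by
      rw [smul_add]; exact LinearMap.map_add (show N →ₗ[A] E from f) _ _⟩ fun a n => by
      have h : MulOpposite.op r • a • n = a • MulOpposite.op r • n := (smul_comm a (MulOpposite.op r) n).symm
      exact (congrArg f h).trans (LinearMap.map_smul (show N →ₗ[A] E from f) a _)
  one_smul f := LinearMap.ext fun n => congrArg f (one_smul Rᵐᵒᵖ n)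
  mul_smul r s f := LinearMap.ext fun n => congrArg f (mul_smul (MulOpposite.op s) (MulOpposite.op r) n)
  smul_zero _ := rfl
  smul_add _ _ _ := rfl
  add_smul r s f := LinearMap.ext fun n =>
    (congrArg f (add_smul (MulOpposite.op r) (MulOpposite.op s) n)).trans
      (LinearMap.map_add (show N →ₗ[A] E from f) _ _)
  zero_smul f := LinearMap.ext fun n =>
    (congrArg f (zero_smul Rᵐᵒᵖ n)).trans (LinearMap.map_zero (show N →ₗ[A] E from f))

theorem HomDual.smul_apply {R : Type*} [Ring R] [Module Rᵐᵒᵖ N] [SMulCommClass A Rᵐᵒᵖ N]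
    (r : R) (f : HomDual A N E) (n : N) : (r • f) n = f (MulOpposite.op r • n) := rfl

end HomDual

/-- The endomorphism ring `S = End_R(N)` of a right `R`-module `N`; it acts on `N` on the left. -/
abbrev EndRing (R : Type u) [Ring R] (N : Type w) [AddCommGroup N] [Module Rᵐᵒᵖ N] : Type w :=
  Module.End Rᵐᵒᵖ N

/-- The maximal ideal `𝔪` of the endomorphism ring `S` when `S` is a (not necessarily commutative)
local ring, namely its Jacobson radical. -/
abbrev endMaximalIdeal (R : Type u) [Ring R] (N : Type w) [AddCommGroup N] [Module Rᵐᵒᵖ N] :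
    Ideal (EndRing R N) :=
  Ideal.jacobson ⊥

/-- If `S` is local then `𝔪` is the set of non-units of `S`. -/
theorem mem_endMaximalIdeal_iff {R : Type u} [Ring R] {N : Type w} [AddCommGroup N]
    [Module Rᵐᵒᵖ N] [IsLocalRing (EndRing R N)] (s : EndRing R N) :
    s ∈ endMaximalIdeal R N ↔ ¬ IsUnit s := by
  constructor
  · intro hs hu
    have h := (Ideal.eq_top_iff_one _).1 (Ideal.eq_top_of_isUnit_mem _ hs hu)
    exact one_ne_zero ((Ideal.mem_bot).1
      ((Ideal.eq_top_iff_one _).1 (Ideal.jacobson_eq_top_iff.1 ((Ideal.eq_top_iff_one _).2 h))))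
  · intro hs
    rw [Ideal.mem_jacobson_iff]
    intro y
    have hys : ¬ IsUnit (-(y * s)) := by
      intro h
      obtain ⟨t, ht⟩ := h.exists_left_inv
      have hu : (-(t * y)) * s = 1 := by rw [← ht]; noncomm_ring
      set u := -(t * y)
      have he : (s * u) * (s * u) = s * u := by
        rw [mul_assoc, ← mul_assoc u s u, hu, one_mul]
      rcases IsLocalRing.isUnit_or_isUnit_of_add_one (add_sub_cancel (s * u) 1) with h1 | h1
      · have h2 : s * u = 1 := h1.mul_left_cancel (by rw [he, mul_one])
        exact hs ⟨⟨s, u, h2, hu⟩, rfl⟩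
      · have h2 : s * u = 0 := h1.mul_left_cancel (by rw [sub_mul, he, one_mul, sub_self, mul_zero])
        have h3 : s = 0 := by
          calc s = s * (u * s) := by rw [hu, mul_one]
            _ = 0 := by rw [← mul_assoc, h2, zero_mul]
        rw [h3, mul_zero] at hu
        exact zero_ne_one hu
    rcases IsLocalRing.isUnit_or_isUnit_of_add_one
      (show -(y * s) + (y * s + 1) = 1 by abel) with h1 | h1
    · exact absurd h1 hys
    · obtain ⟨z, hz⟩ := h1.exists_left_inv
      refine ⟨z, ?_⟩
      rw [Ideal.mem_bot, ← hz]
      noncomm_ring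

/-- The local dual `Hom_S(N, E(S/𝔪))` of a right `R`-module `N` with local endomorphism ring `S`,
a left `R`-module. -/
abbrev LocalDual (R : Type u) [Ring R] (N : Type w) [AddCommGroup N] [Module Rᵐᵒᵖ N] : Type w :=
  HomDual (EndRing R N) N (InjectiveHull (EndRing R N) (EndRing R N ⧸ endMaximalIdeal R N))

/-- The `k`-dual `N^* = Hom_k(N, k)` of a right module `N` over a `k`-algebra `R`, a left
`R`-module. -/
abbrev KDual (k : Type v) [Field k] (N : Type w) [AddCommGroup N] [Module k N] :=
  HomDual k N k

/-!
Write `S = End_R(N)` and `𝔪` for its Jacobson radical, so that `S = k + 𝔪` with residue map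
`π : S → k`. The hypothesis that `k → S ⧸ 𝔪` is bijective already makes `S` local.

The descending chain condition on pp-definable subgroups makes `N` algebraically compact. In the
form needed here, a partial endomorphism of `N` that preserves pp formulas extends to `N`
(`PreservesPP.exists_end`): the image of one further element only has to satisfy a single formula,
one whose pp-definable subgroup is minimal. Two facts about `N` as an `S`-module follow.

* Every nonzero quotient `N ⧸ K` contains a nonzero element annihilated by `𝔪`
  (`exists_notMem_jacobson_smul_mem`).
* The orbit `S (n, n')` of a pair is a pp-definable subgroup of `N²` (`exists_pp_orbit_pair`).

*The isomorphism.* Let `E` be the injective hull of `S ⧸ 𝔪 = k`, and let `f` be a functional on `E`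
with `f 1 = 1` on `S ⧸ 𝔪`. The isomorphism is `g ↦ f ∘ g`. It is injective since `S ⧸ 𝔪` is contained
in every nonzero submodule of `E`. For surjectivity, `f` embeds `E` in `Hom_k(S, k)` as a direct
summand, while `Hom_k(N, k) = Hom_S(N, Hom_k(S, k))`. The elements of `Hom_k(S, k)` annihilated by
`𝔪` are the multiples of `π`, which belong to `E`; so by the first fact no nonzero `S`-linear map
from `N` lands in the complement of `E` (`exists_functional_bijective`).

*Indecomposability.* An `R`-endomorphism `α` of `N^*` need not be the transpose of an element of
`S`, but it preserves annihilators of pp-definable subgroups, in `N^*` and likewise in `(N^*)²`.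
Hence `f (s n) = g (s n')` for all `s ∈ S` implies `α f n = α g n'`, by the second fact
(`apply_eq_apply_of_forall_end`). If `N^* = P ⊕ Q` with nonzero `f ∈ P` and `g ∈ Q`, then by the
first fact there are `n` and `n'` with `f (s n) = π s = g (s n')` for all `s`, and the projection
onto `P` gives `1 = 0`.
-/

/-! ### Finite linear systems over a right module -/

namespace PPFormula

section Solves

variable {R : Type u} [Ring R] {N : Type w} [AddCommGroup N] [Module Rᵐᵒᵖ N]

/-- `φ.Solves x a` says that `x` satisfies the inhomogeneous variant of `φ` with right-hand sides
`a`, that is, the pp formula with parameters `∃ y, (x, y) H = a`. -/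
def Solves (φ : PPFormula R) (x : N) (a : Fin φ.eqs → N) : Prop :=
  ∃ y : Fin φ.vars → N, ∀ j : Fin φ.eqs,
    MulOpposite.op (φ.coeff j) • x + ∑ i, MulOpposite.op (φ.coeffs i j) • y i = a j

theorem mem_eval_iff {φ : PPFormula R} {x : N} : x ∈ φ.eval N ↔ φ.Solves x 0 := Iff.rfl

theorem Solves.add {φ : PPFormula R} {x x' : N} {a a' : Fin φ.eqs → N}
    (h : φ.Solves x a) (h' : φ.Solves x' a') : φ.Solves (x + x') (a + a') := by
  obtain ⟨y, hy⟩ := h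
  obtain ⟨z, hz⟩ := h'
  refine ⟨y + z, fun j => ?_⟩
  rw [Pi.add_apply, ← hy j, ← hz j]
  simp only [smul_add, Pi.add_apply, Finset.sum_add_distrib]
  abel

theorem Solves.neg {φ : PPFormula R} {x : N} {a : Fin φ.eqs → N}
    (h : φ.Solves x a) : φ.Solves (-x) (-a) := by
  obtain ⟨y, hy⟩ := h
  refine ⟨-y, fun j => ?_⟩
  rw [Pi.neg_apply, ← hy j]
  simp only [smul_neg, Pi.neg_apply, Finset.sum_neg_distrib, neg_add]

theorem Solves.sub {φ : PPFormula R} {x x' : N} {a a' : Fin φ.eqs → N}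
    (h : φ.Solves x a) (h' : φ.Solves x' a') : φ.Solves (x - x') (a - a') := by
  rw [sub_eq_add_neg, sub_eq_add_neg]
  exact h.add h'.neg

theorem Solves.map {φ : PPFormula R} {x : N} {a : Fin φ.eqs → N} (h : φ.Solves x a)
    (s : Module.End Rᵐᵒᵖ N) : φ.Solves (s x) (fun j => s (a j)) := by
  obtain ⟨y, hy⟩ := h
  refine ⟨fun i => s (y i), fun j => ?_⟩
  have h := congrArg s (hy j)
  simpa only [map_add, map_sum, map_smul] using h

/-- The conjunction of two pp formulas in the same free variable. -/
abbrev conj (φ ψ : PPFormula R) : PPFormula R where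
  vars := φ.vars + ψ.vars
  eqs := φ.eqs + ψ.eqs
  coeff := Fin.append φ.coeff ψ.coeff
  coeffs := Fin.append (fun i => Fin.append (φ.coeffs i) 0) (fun i => Fin.append 0 (ψ.coeffs i))

theorem solves_conj {φ ψ : PPFormula R} {x : N} {a : Fin φ.eqs → N} {b : Fin ψ.eqs → N} :
    (φ.conj ψ).Solves x (Fin.append a b : Fin (φ.eqs + ψ.eqs) → N) ↔
      φ.Solves x a ∧ ψ.Solves x b := by
  constructor
  · rintro ⟨y, hy⟩
    refine ⟨⟨fun i => y (Fin.castAdd _ i), fun j => ?_⟩, ⟨fun i => y (Fin.natAdd _ i), fun j => ?_⟩⟩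
    · have h := hy (Fin.castAdd _ j)
      dsimp only [conj] at h
      rw [Fin.sum_univ_add] at h
      simpa using h
    · have h := hy (Fin.natAdd _ j)
      dsimp only [conj] at h
      rw [Fin.sum_univ_add] at h
      simpa using h
  · rintro ⟨⟨y, hy⟩, ⟨z, hz⟩⟩
    refine ⟨(Fin.append y z : Fin (φ.vars + ψ.vars) → N), fun j => ?_⟩
    dsimp only [conj] at j ⊢
    rw [Fin.sum_univ_add]
    induction j using Fin.addCases with
    | left j => simpa using hy j
    | right j => simpa using hz j

theorem eval_conj (φ ψ : PPFormula R) : (φ.conj ψ).eval N = φ.eval N ⊓ ψ.eval N := by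
  ext x
  have h0 : (0 : Fin (φ.eqs + ψ.eqs) → N) = Fin.append 0 0 := by
    ext j
    induction j using Fin.addCases <;> simp
  rw [AddSubgroup.mem_inf, mem_eval_iff, mem_eval_iff, mem_eval_iff, ← solves_conj, ← h0]

/-- The pp formula that quantifies the free variable of `φ` and has a new free variable with
coefficients `r`. -/
abbrev bind (φ : PPFormula R) (r : Fin φ.eqs → R) : PPFormula R where
  vars := φ.vars + 1
  eqs := φ.eqs
  coeff := r
  coeffs := Fin.cons φ.coeff φ.coeffs

theorem solves_bind {φ : PPFormula R} {r : Fin φ.eqs → R} {c : N} {a : Fin φ.eqs → N} :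
    (φ.bind r).Solves c a ↔
      ∃ x, φ.Solves x (fun j => a j - MulOpposite.op (r j) • c) := by
  constructor
  · rintro ⟨y, hy⟩
    refine ⟨y (0 : Fin (φ.vars + 1)), fun i => y i.succ, fun j => ?_⟩
    have h := hy j
    dsimp only [bind] at h
    rw [Fin.sum_univ_succ] at h
    rw [eq_sub_iff_add_eq', ← h]
    rfl
  · rintro ⟨x, y, hy⟩
    refine ⟨(Fin.cons x y : Fin (φ.vars + 1) → N), fun j => ?_⟩
    have h := hy j
    dsimp only [bind]
    rw [Fin.sum_univ_succ]
    rw [eq_sub_iff_add_eq'] at h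
    exact h

/-- The descending chain condition, as existence of minimal elements. -/
theorem exists_minimal_eval (hN : IsSigmaPureInjective R N) (P : PPFormula R → Prop)
    (hP : ∃ φ, P φ) :
    ∃ φ, P φ ∧ ∀ ψ, P ψ → ψ.eval N ≤ φ.eval N → φ.eval N ≤ ψ.eval N := by
  have wf : WellFounded fun φ ψ : PPFormula R => φ.eval N < ψ.eval N := by
    rw [wellFounded_iff_isEmpty_descending_chain]
    refine ⟨fun ⟨f, hf⟩ => hN ⟨f, strictAnti_nat_of_succ_lt hf⟩⟩
  obtain ⟨φ, hφ, hmin⟩ := wf.has_min {φ | P φ} hP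
  refine ⟨φ, hφ, fun ψ hψ hle => ?_⟩
  by_contra hne
  exact hmin ψ hψ (lt_of_le_not_ge hle hne)

end Solves

end PPFormula

/-! ### Extending partial endomorphisms that preserve pp formulas -/

section Extension

variable {R : Type u} [Ring R] {N : Type w} [AddCommGroup N] [Module Rᵐᵒᵖ N]

open PPFormula

/-- A submodule `Γ` of `N × N`, viewed as the graph of a partial endomorphism of `N`, preserves
solvability of finite linear systems with right-hand sides in its domain. This forces `Γ` to be
single-valued. -/
def PreservesPP (Γ : Submodule Rᵐᵒᵖ (N × N)) : Prop :=
  ∀ (φ : PPFormula R) (x : N) (p : Fin φ.eqs → N × N), (∀ j, p j ∈ Γ) →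
    φ.Solves x (fun j => (p j).1) → ∃ x', φ.Solves x' (fun j => (p j).2)

theorem preservesPP_bot : PreservesPP (⊥ : Submodule Rᵐᵒᵖ (N × N)) := by
  intro φ x p hp h
  have hp0 : p = 0 := funext fun j => (Submodule.mem_bot _).1 (hp j)
  subst hp0
  exact ⟨x, h⟩

/-- A partial endomorphism extends by `c ↦ d` if `d` satisfies the images of all pp formulas with
parameters in the domain that hold at `c`. -/
theorem preservesPP_sup_span_singleton {Γ : Submodule Rᵐᵒᵖ (N × N)} {c d : N}
    (h : ∀ (φ : PPFormula R) (p : Fin φ.eqs → N × N), (∀ j, p j ∈ Γ) →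
      φ.Solves c (fun j => (p j).1) → φ.Solves d (fun j => (p j).2)) :
    PreservesPP (Γ ⊔ Submodule.span Rᵐᵒᵖ {(c, d)}) := by
  intro φ x p hp hx
  have hp' : ∀ j, ∃ q ∈ Γ, ∃ r : Rᵐᵒᵖ, q + r • (c, d) = p j := fun j => by
    obtain ⟨q, hq, z, hz, hqz⟩ := Submodule.mem_sup.1 (hp j)
    obtain ⟨r, rfl⟩ := Submodule.mem_span_singleton.1 hz
    exact ⟨q, hq, r, hqz⟩
  choose q hq r hr using hp'
  -- the summand `c * r j` of the right-hand sides becomes part of the left-hand side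
  have hc : (φ.bind fun j => -(r j).unop).Solves c (fun j => (q j).1) := by
    refine solves_bind.2 ⟨x, ?_⟩
    convert hx using 2 with j
    rw [← hr j]
    simp
  obtain ⟨x', hx'⟩ := solves_bind.1 (h (φ.bind fun j => -(r j).unop) q hq hc)
  refine ⟨x', ?_⟩
  convert hx' using 2 with j
  rw [← hr j]
  simp

/-- Among the pp formulas with parameters in `A` that hold at `c`, `(φ, a)` is one whose associated
pp-definable subgroup is minimal. Such a formula exists by the chain condition, and it implies all
the others. -/
structure IsMinimalAt (A : Submodule Rᵐᵒᵖ N) (c : N) (φ : PPFormula R) (a : Fin φ.eqs → N) :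
    Prop where
  mem : ∀ j, a j ∈ A
  solves : φ.Solves c a
  minimal : ∀ (ψ : PPFormula R) (b : Fin ψ.eqs → N), (∀ j, b j ∈ A) → ψ.Solves c b →
    ψ.eval N ≤ φ.eval N → φ.eval N ≤ ψ.eval N

theorem exists_isMinimalAt (hN : IsSigmaPureInjective R N) (A : Submodule Rᵐᵒᵖ N) (c : N) :
    ∃ (φ : PPFormula R) (a : Fin φ.eqs → N), IsMinimalAt A c φ a := by
  obtain ⟨φ, ⟨a, ha, hc⟩, hmin⟩ := exists_minimal_eval hN
    (fun φ => ∃ a : Fin φ.eqs → N, (∀ j, a j ∈ A) ∧ φ.Solves c a)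
    ⟨⟨0, 0, Fin.elim0, Fin.elim0⟩, Fin.elim0, fun j => j.elim0, Fin.elim0, fun j => j.elim0⟩
  exact ⟨φ, a, ha, hc, fun ψ b hb hψ => hmin ψ ⟨b, hb, hψ⟩⟩

/-- A partial endomorphism extends by `c ↦ d` as soon as `d` satisfies the image of one minimal
formula that holds at `c`. -/
theorem IsMinimalAt.preservesPP {A : Submodule Rᵐᵒᵖ N} {c d : N} {φ : PPFormula R}
    {a b : Fin φ.eqs → N} (h : IsMinimalAt A c φ a) {Γ : Submodule Rᵐᵒᵖ (N × N)}
    (hΓ : PreservesPP Γ) (hA : ∀ p ∈ Γ, p.1 ∈ A) (hab : ∀ j, (a j, b j) ∈ Γ) (hd : φ.Solves d b) :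
    PreservesPP (Γ ⊔ Submodule.span Rᵐᵒᵖ {(c, d)}) := by
  refine preservesPP_sup_span_singleton fun ψ p hp hc => ?_
  -- the solutions of `ψ ∧ φ` form a coset of the same subgroup as the solutions of `φ`
  have hq : ∀ j, (Fin.append p (fun j => (a j, b j)) : Fin (ψ.eqs + φ.eqs) → N × N) j ∈ Γ := by
    intro j
    induction j using Fin.addCases with
    | left j => simpa using hp j
    | right j => simpa using hab j
  have happ : ∀ f : N × N → N, (fun j => f ((Fin.append p (fun j => (a j, b j)) :
      Fin (ψ.eqs + φ.eqs) → N × N) j)) =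
      Fin.append (fun j => f (p j)) (fun j => f (a j, b j)) := by
    intro f
    ext j
    induction j using Fin.addCases <;> simp
  have hc' : (ψ.conj φ).Solves c (fun j => ((Fin.append p (fun j => (a j, b j)) :
      Fin (ψ.eqs + φ.eqs) → N × N) j).1) := by
    rw [happ Prod.fst]
    exact solves_conj.2 ⟨hc, h.solves⟩
  obtain ⟨x', hx'⟩ := hΓ (ψ.conj φ) c _ hq hc'
  rw [happ Prod.snd] at hx'
  obtain ⟨hψ, hφ⟩ := solves_conj.1 hx'
  have hle := h.minimal (ψ.conj φ) _ (fun j => hA _ (hq j)) hc'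
    (by rw [eval_conj]; exact inf_le_right)
  have hmem : d - x' ∈ φ.eval N := by
    have := hd.sub hφ
    rwa [sub_self] at this
  have hmem' := hle hmem
  rw [eval_conj] at hmem'
  have := hψ.add (mem_eval_iff.1 hmem'.1)
  rwa [add_sub_cancel, add_zero] at this

/-- A partial endomorphism of a Σ-pure-injective module that preserves pp formulas extends to the
whole module. -/
theorem PreservesPP.exists_end (hN : IsSigmaPureInjective R N) {Γ : Submodule Rᵐᵒᵖ (N × N)}
    (hΓ : PreservesPP Γ) : ∃ s : Module.End Rᵐᵒᵖ N, ∀ p ∈ Γ, s p.1 = p.2 := by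
  obtain ⟨G, hΓG, hG⟩ : ∃ G, Γ ≤ G ∧ Maximal (· ∈ {G | PreservesPP G}) G := by
    refine zorn_le_nonempty₀ {G | PreservesPP G}
      (fun C hC hchain y hy => ⟨sSup C, ?_, fun z hz => le_sSup hz⟩) Γ hΓ
    intro φ x p hp hx
    have hp' : ∀ j, ∃ G ∈ C, p j ∈ G := fun j =>
      (Submodule.mem_sSup_of_directed ⟨y, hy⟩ hchain.directedOn).1 (hp j)
    choose F hFC hF using hp'
    have : Nonempty C := ⟨⟨y, hy⟩⟩
    obtain ⟨G, hG⟩ := hchain.directedOn.directed_val.finite_le fun j => (⟨F j, hFC j⟩ : C)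
    exact hC G.2 φ x p (fun j => hG j (hF j)) hx
  have hGp : PreservesPP G := hG.prop
  let pr : G →ₗ[Rᵐᵒᵖ] N := (LinearMap.fst Rᵐᵒᵖ N N).comp G.subtype
  have hinj : Function.Injective pr := by
    rw [← LinearMap.ker_eq_bot, Submodule.eq_bot_iff]
    rintro ⟨⟨z, b⟩, hz⟩ (rfl : z = 0)
    -- the unsolvable equation `0 = b` would come from the solvable equation `0 = 0`
    obtain ⟨x', y, hy⟩ := hGp ⟨0, 1, 0, Fin.elim0⟩ 0 (fun _ => (0, b)) (fun _ => hz)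
      ⟨Fin.elim0, fun j => by simp⟩
    have := hy 0
    simp only [Pi.zero_apply, MulOpposite.op_zero, zero_smul, Finset.univ_eq_empty,
      Finset.sum_empty, add_zero] at this
    exact Subtype.ext (Prod.ext rfl this.symm)
  have hsurj : Function.Surjective pr := by
    intro c
    obtain ⟨φ, a, h⟩ := exists_isMinimalAt hN (G.map (LinearMap.fst Rᵐᵒᵖ N N)) c
    have ha : ∀ j, ∃ b, (a j, b) ∈ G := fun j => by
      obtain ⟨⟨a', b⟩, hp, hpa⟩ := h.mem j
      exact ⟨b, by rw [← hpa]; exact hp⟩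
    choose b hab using ha
    obtain ⟨d, hd⟩ := hGp φ c (fun j => (a j, b j)) hab h.solves
    have hext := h.preservesPP hGp (fun p hp => ⟨p, hp, rfl⟩) hab hd
    have hmem : (c, d) ∈ G := hG.2 hext le_sup_left
      (Submodule.mem_sup_right (Submodule.mem_span_singleton_self _))
    exact ⟨⟨(c, d), hmem⟩, rfl⟩
  let e := LinearEquiv.ofBijective pr ⟨hinj, hsurj⟩
  refine ⟨(LinearMap.snd Rᵐᵒᵖ N N).comp (G.subtype.comp e.symm.toLinearMap), fun p hp => ?_⟩
  have : e.symm p.1 = ⟨p, hΓG hp⟩ := e.symm_apply_eq.2 rfl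
  simp [this]

/-- In a Σ-pure-injective module, an element whose pp type contains that of `a` is the image of `a`
under an endomorphism. -/
theorem exists_end_apply_eq (hN : IsSigmaPureInjective R N) {a b : N}
    (h : ∀ φ : PPFormula R, a ∈ φ.eval N → b ∈ φ.eval N) :
    ∃ s : Module.End Rᵐᵒᵖ N, s a = b := by
  have hΓ := preservesPP_sup_span_singleton (Γ := (⊥ : Submodule Rᵐᵒᵖ (N × N))) (c := a) (d := b)
    fun φ p hp ha => by
      have hp0 : p = 0 := funext fun j => (Submodule.mem_bot _).1 (hp j)
      subst hp0
      exact h φ ha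
  obtain ⟨s, hs⟩ := hΓ.exists_end hN
  exact ⟨s, hs _ (Submodule.mem_sup_right (Submodule.mem_span_singleton_self _))⟩

/-- The cyclic `S`-submodule of `N²` generated by `(n, n')`, where `S = End_R(N)`, is the solution
set of a finite linear system. -/
theorem exists_pp_orbit_pair (hN : IsSigmaPureInjective R N) (n n' : N) :
    ∃ (φ ψ : PPFormula R) (r : Fin φ.eqs → R),
      φ.Solves n (fun j => MulOpposite.op (r j) • n') ∧ ψ.Solves n' 0 ∧
      ∀ x x' : N, φ.Solves x (fun j => MulOpposite.op (r j) • x') → ψ.Solves x' 0 →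
        ∃ s : Module.End Rᵐᵒᵖ N, s n = x ∧ s n' = x' := by
  obtain ⟨ψ, a', h'⟩ := exists_isMinimalAt hN ⊥ n'
  obtain rfl : a' = 0 := funext fun j => (Submodule.mem_bot _).1 (h'.mem j)
  obtain ⟨φ, a, h⟩ := exists_isMinimalAt hN (Submodule.span Rᵐᵒᵖ {n'}) n
  have ha : ∀ j, ∃ r : R, MulOpposite.op r • n' = a j := fun j => by
    obtain ⟨r, hr⟩ := Submodule.mem_span_singleton.1 (h.mem j)
    exact ⟨r.unop, hr⟩
  choose r hr using ha
  obtain rfl : (fun j => MulOpposite.op (r j) • n') = a := funext hr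
  refine ⟨φ, ψ, r, h.solves, h'.solves, fun x x' hx hx' => ?_⟩
  have h1 := h'.preservesPP (b := 0) preservesPP_bot
    (fun p hp => by rw [(Submodule.mem_bot _).1 hp]; exact zero_mem _)
    (fun j => zero_mem _) hx'
  rw [bot_sup_eq] at h1
  have h2 := h.preservesPP h1
    (fun p hp => by
      obtain ⟨t, rfl⟩ := Submodule.mem_span_singleton.1 hp
      exact Submodule.mem_span_singleton.2 ⟨t, rfl⟩)
    (fun j => Submodule.mem_span_singleton.2 ⟨MulOpposite.op (r j), rfl⟩) hx
  obtain ⟨s, hs⟩ := h2.exists_end hN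
  exact ⟨s, hs _ (Submodule.mem_sup_right (Submodule.mem_span_singleton_self _)),
    hs _ (Submodule.mem_sup_left (Submodule.mem_span_singleton_self _))⟩

end Extension

/-! ### The action of the endomorphism ring -/

section Orbits

variable {R : Type u} [Ring R] {N : Type w} [AddCommGroup N] [Module Rᵐᵒᵖ N]

theorem eq_zero_of_smul_smul_eq {S : Type*} [Ring S] {M : Type*} [AddCommGroup M] [Module S M]
    {s t : S} (hs : s ∈ Ideal.jacobson (⊥ : Ideal S)) {n : M} (h : t • s • n = n) : n = 0 := by
  obtain ⟨z, hz⟩ := Ideal.mem_jacobson_iff.1 hs (-t)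
  rw [Ideal.mem_bot] at hz
  have hz' : z * (1 - t * s) = 1 := by
    rw [← sub_eq_zero, ← hz]
    noncomm_ring
  rw [← one_smul S n, ← hz', mul_smul, sub_smul, one_smul, mul_smul, h, sub_self, smul_zero]

/-- Every nonzero quotient of `N` over `S = End_R(N)` has an element annihilated by the radical
of `S`: take `n` outside `K` in a pp-definable subgroup minimal among those not contained in `K`.
If `s n ∉ K` then `n` lies in every pp-definable subgroup that contains `s n`, so `n = t s n`. -/
theorem exists_notMem_jacobson_smul_mem (hN : IsSigmaPureInjective R N)
    {K : Submodule (EndRing R N) N} (hK : K ≠ ⊤) :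
    ∃ n ∉ K, ∀ s ∈ endMaximalIdeal R N, s • n ∈ K := by
  obtain ⟨φ, hφ, hmin⟩ := PPFormula.exists_minimal_eval hN
    (fun φ => ∃ x ∈ φ.eval N, x ∉ K) (by
      obtain ⟨x, hx⟩ := SetLike.exists_not_mem_of_ne_top K hK
      exact ⟨⟨0, 0, Fin.elim0, Fin.elim0⟩, x, ⟨Fin.elim0, fun j => j.elim0⟩, hx⟩)
  obtain ⟨n, hn, hnK⟩ := hφ
  refine ⟨n, hnK, fun s hs => ?_⟩
  by_contra hsn
  have hsφ : s • n ∈ φ.eval N := by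
    have := (PPFormula.mem_eval_iff.1 hn).map s
    simpa [PPFormula.mem_eval_iff, Pi.zero_def] using this
  obtain ⟨t, ht⟩ := exists_end_apply_eq hN (a := s • n) (b := n) fun ψ hψ => by
    have h := hmin (ψ.conj φ) ⟨s • n, by rw [PPFormula.eval_conj]; exact ⟨hψ, hsφ⟩, hsn⟩
      (by rw [PPFormula.eval_conj]; exact inf_le_right) hn
    rw [PPFormula.eval_conj] at h
    exact h.1
  exact hnK (by rw [eq_zero_of_smul_smul_eq hs (show t • s • n = n from ht)]; exact zero_mem _)

end Orbits

/-! ### Comparison of the two duals -/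

section Comparison

variable {k : Type v} [Field k] {S : Type w} [Ring S] [Algebra k S]

/-- The map from an `S`-module to the coinduced module `Hom_k(S, k)` that corresponds to a
`k`-linear functional on it. -/
def coinduce {M : Type*} [AddCommGroup M] [Module k M] [Module S M] [IsScalarTower k S M]
    (f : M →ₗ[k] k) : M →ₗ[S] HomDual k S k where
  toFun x := show S →ₗ[k] k from f ∘ₗ (LinearMap.toSpanSingleton S M x).restrictScalars k
  map_add' x y := LinearMap.ext fun s => by
    show f (s • (x + y)) = f (s • x) + f (s • y)
    rw [smul_add, map_add]
  map_smul' t x := LinearMap.ext fun s => by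
    show f (s • t • x) = f ((s * t) • x)
    rw [mul_smul]

theorem coinduce_apply {M : Type*} [AddCommGroup M] [Module k M] [Module S M]
    [IsScalarTower k S M] (f : M →ₗ[k] k) (x : M) (s : S) : coinduce f x s = f (s • x) := rfl

/-- Let `S = k + 𝔪`, let `E` be an injective hull of `S ⧸ 𝔪`, and let `N` be an `S`-module all of
whose nonzero quotients contain a nonzero element annihilated by `𝔪`. Composition with a
functional on `E` that is nonzero on `S ⧸ 𝔪` identifies `Hom_S(N, E)` with `Hom_k(N, k)`. -/
theorem exists_functional_bijective {m : Ideal S} (hm1 : (1 : S) ∉ m)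
    (hm : ∀ s : S, ∃ c : k, s - algebraMap k S c ∈ m)
    {E : Type w} [AddCommGroup E] [Module S E] [Module k E] [IsScalarTower k S E]
    {i : (S ⧸ m) →ₗ[S] E} (hi : IsInjectiveHull i)
    {N : Type*} [AddCommGroup N] [Module k N] [Module S N] [IsScalarTower k S N]
    (hN : ∀ K : Submodule S N, K ≠ ⊤ → ∃ n ∉ K, ∀ s ∈ m, s • n ∈ K) :
    ∃ f : E →ₗ[k] k, (∀ g : N →ₗ[S] E, (∀ n, f (g n) = 0) → g = 0) ∧
      ∀ h : N →ₗ[k] k, ∃ g : N →ₗ[S] E, ∀ n, f (g n) = h n := by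
  set e : E := i (Submodule.Quotient.mk 1) with he
  have he0 : e ≠ 0 := fun h => hm1 ((Submodule.Quotient.mk_eq_zero m).1
    (hi.embedding (h.trans (map_zero i).symm)))
  have hem : ∀ (s : S), i (Submodule.Quotient.mk s) = s • e := fun s => by
    rw [he, ← map_smul, ← Submodule.Quotient.mk_smul, smul_eq_mul, mul_one]
  have hme : ∀ s ∈ m, s • e = 0 := fun s hs => by
    rw [← hem, (Submodule.Quotient.mk_eq_zero m).2 hs, map_zero]
  -- by essentiality, the socle `k e` lies in every nonzero submodule
  have hsoc : ∀ q : Submodule S E, e ∉ q → q = ⊥ := by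
    intro q hq
    refine hi.essential q ((Submodule.eq_bot_iff _).2 ?_)
    rintro _ ⟨hx, ⟨y, rfl⟩⟩
    obtain ⟨s, rfl⟩ := Submodule.Quotient.mk_surjective m y
    obtain ⟨c, hc⟩ := hm s
    have hsc : s • e = c • e := by
      rw [← algebraMap_smul S c e, ← sub_eq_zero, ← sub_smul, hme _ hc]
    rw [hem, hsc] at hx ⊢
    by_cases hc0 : c = 0
    · rw [hc0, zero_smul]
    · refine absurd ?_ hq
      have := q.smul_mem (algebraMap k S c⁻¹) hx
      rwa [algebraMap_smul, smul_smul, inv_mul_cancel₀ hc0, one_smul] at this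
  obtain ⟨f, hf⟩ := Module.Projective.exists_dual_eq_one k he0
  refine ⟨f, fun g hg => ?_, fun h => ?_⟩
  · rw [← LinearMap.range_eq_bot]
    refine hsoc _ ?_
    rintro ⟨n, hn⟩
    have := hg n
    rw [hn, hf] at this
    exact one_ne_zero this
  · -- `E` is a direct summand of `Hom_k(S, k)`, with projection `ρ`
    have hinj : Function.Injective (coinduce (S := S) f) := by
      rw [← LinearMap.ker_eq_bot]
      refine hsoc _ fun h => ?_
      have h1 : coinduce (S := S) f e 1 = 0 := by rw [LinearMap.mem_ker.1 h]; rfl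
      rw [coinduce_apply, one_smul, hf] at h1
      exact one_ne_zero h1
    obtain ⟨ρ, hρ⟩ := (Module.Baer.of_injective hi.injective).extension_property
      (coinduce (S := S) f) hinj LinearMap.id
    have hρ' : ∀ x, ρ (coinduce (S := S) f x) = x := fun x => LinearMap.congr_fun hρ x
    let D : N →ₗ[S] HomDual k S k :=
      coinduce h - (coinduce (S := S) f) ∘ₗ ρ ∘ₗ (coinduce (S := S) h)
    have hρD : ∀ n, ρ (D n) = 0 := fun n => by
      simp [D, hρ']
    -- the complement `ker ρ` of `E` has no nonzero element annihilated by `𝔪`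
    have hD : LinearMap.ker D = ⊤ := by
      by_contra hne
      obtain ⟨n, hn, hmn⟩ := hN _ hne
      refine hn ?_
      have hDm : ∀ s ∈ m, D n s = 0 := fun s hs => by
        have h1 : s • D n = 0 := by rw [← map_smul]; exact hmn s hs
        have h2 : (s • D n) 1 = D n s := by
          rw [HomDual.smul_apply, op_smul_eq_mul, one_mul]
        rw [← h2, h1]
        rfl
      have hDf : D n = coinduce f (D n 1 • e) := by
        refine LinearMap.ext fun s => ?_
        show D n s = f (s • D n 1 • e)
        obtain ⟨c, hc⟩ := hm s
        have hs : s = c • (1 : S) + (s - algebraMap k S c) := by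
          rw [Algebra.smul_def, mul_one, add_sub_cancel]
        have h1 : D n s = c * D n 1 := by
          have h2 := LinearMap.map_add (show S →ₗ[k] k from D n) (c • 1) (s - algebraMap k S c)
          rw [← hs] at h2
          refine h2.trans ?_
          have h3 : (show S →ₗ[k] k from D n) (c • 1) = c * D n 1 :=
            LinearMap.map_smul (show S →ₗ[k] k from D n) c 1
          have h4 : (show S →ₗ[k] k from D n) (s - algebraMap k S c) = 0 := hDm _ hc
          rw [h3, h4, add_zero]
        have h5 : s • D n 1 • e = c • D n 1 • e := by
          rw [← sub_eq_zero, ← algebraMap_smul S c (D n 1 • e), ← sub_smul,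
            smul_comm, hme _ hc, smul_zero]
        rw [h1, h5, map_smul, map_smul, hf, smul_eq_mul, smul_eq_mul, mul_one]
      have h0 := hρD n
      rw [hDf, hρ'] at h0
      rw [LinearMap.mem_ker, hDf, h0, map_zero]
    refine ⟨ρ ∘ₗ coinduce (S := S) h, fun n => ?_⟩
    have hn : D n = 0 := by rw [← LinearMap.mem_ker, hD]; trivial
    have h1 : coinduce (S := S) h n = coinduce f (ρ (coinduce (S := S) h n)) := sub_eq_zero.1 hn
    have h2 := congrArg (fun g : HomDual k S k => g 1) h1
    simp only [coinduce_apply, one_smul] at h2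
    exact h2.symm

end Comparison

/-! ### Indecomposability of the `k`-dual -/

section Indecomposable

variable {k : Type v} [Field k] {R : Type u} [Ring R] [Algebra k R] {N : Type w} [AddCommGroup N]
  [Module k N] [Module Rᵐᵒᵖ N] [IsScalarTower k Rᵐᵒᵖ N]

theorem HomDual.sum_apply {A : Type*} [Ring A] {M E : Type*} [AddCommGroup M] [Module A M]
    [AddCommGroup E] [Module A E] {ι : Type*} (s : Finset ι) (f : ι → HomDual A M E) (n : M) :
    (∑ i ∈ s, f i) n = ∑ i ∈ s, f i n :=
  LinearMap.sum_apply (M := M) (M₂ := E) s f n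

/-- Linear duality: a tuple of functionals that vanishes on the solutions in `N` of the finite
system `x H = 0` is an `R`-linear combination of the equations, that is, of the form `H h`. -/
theorem exists_eq_sum_smul_of_forall_solution {ι κ : Type} [Fintype ι] [Fintype κ]
    (H : ι → κ → R) (F : ι → KDual k N)
    (hF : ∀ x : ι → N, (∀ j, ∑ i, MulOpposite.op (H i j) • x i = 0) → ∑ i, F i (x i) = 0) :
    ∃ h : κ → KDual k N, ∀ i, F i = ∑ j, H i j • h j := by
  classical
  let A : (ι → N) →ₗ[k] (κ → N) :=
    { toFun := fun x j => ∑ i, MulOpposite.op (H i j) • x i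
      map_add' := fun x y => by
        ext j
        simp [smul_add, Finset.sum_add_distrib]
      map_smul' := fun c x => by
        ext j
        simp [Finset.smul_sum, smul_comm c] }
  let B : (ι → N) →ₗ[k] k := ∑ i, (show N →ₗ[k] k from F i) ∘ₗ LinearMap.proj i
  have hB : ∀ x, B x = ∑ i, F i (x i) := fun x => by
    simp only [B, LinearMap.sum_apply]
    rfl
  have hmem : B ∈ (LinearMap.ker A).dualAnnihilator := by
    rw [Submodule.mem_dualAnnihilator]
    intro x hx
    rw [hB]
    exact hF x fun j => congrFun (LinearMap.mem_ker.1 hx) j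
  rw [← LinearMap.range_dualMap_eq_dualAnnihilator_ker] at hmem
  obtain ⟨C, hC⟩ := hmem
  let h : κ → KDual k N := fun j => show N →ₗ[k] k from C ∘ₗ LinearMap.single k (fun _ => N) j
  refine ⟨h, fun i => ?_⟩
  refine LinearMap.ext fun n => ?_
  have h1 : B (Pi.single i n) = F i n := by
    rw [hB, Finset.sum_eq_single i]
    · rw [Pi.single_eq_same]
    · intro j _ hj
      rw [Pi.single_eq_of_ne hj]
      exact LinearMap.map_zero (show N →ₗ[k] k from F j)
    · simp
  have h2 : A (Pi.single i n) = ∑ j, Pi.single j (MulOpposite.op (H i j) • n) := by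
    rw [Finset.univ_sum_single (fun j => MulOpposite.op (H i j) • n)]
    ext j
    show ∑ l, MulOpposite.op (H l j) • (Pi.single i n : ι → N) l = _
    rw [Finset.sum_eq_single i]
    · rw [Pi.single_eq_same]
    · intro l _ hl
      rw [Pi.single_eq_of_ne hl, smul_zero]
    · simp
  have h3 : B (Pi.single i n) = C (A (Pi.single i n)) := by rw [← hC]; rfl
  refine h1.symm.trans (h3.trans ?_)
  rw [h2, map_sum]
  exact (HomDual.sum_apply Finset.univ (fun j => H i j • h j) n).symm

/-- `R`-linear endomorphisms of the `k`-dual preserve the annihilators of solution sets of finite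
linear systems. -/
theorem sum_apply_eq_zero_of_forall_solution {ι κ : Type} [Fintype ι] [Fintype κ]
    (H : ι → κ → R) (F : ι → KDual k N)
    (hF : ∀ x : ι → N, (∀ j, ∑ i, MulOpposite.op (H i j) • x i = 0) → ∑ i, F i (x i) = 0)
    (α : KDual k N →ₗ[R] KDual k N) {x : ι → N}
    (hx : ∀ j, ∑ i, MulOpposite.op (H i j) • x i = 0) : ∑ i, α (F i) (x i) = 0 := by
  obtain ⟨h, hh⟩ := exists_eq_sum_smul_of_forall_solution H F hF
  have h1 : ∀ i, α (F i) (x i) = ∑ j, α (h j) (MulOpposite.op (H i j) • x i) := fun i => by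
    rw [hh i, map_sum, HomDual.sum_apply]
    refine Finset.sum_congr rfl fun j _ => ?_
    rw [map_smul, HomDual.smul_apply]
  simp only [h1]
  rw [Finset.sum_comm]
  refine Finset.sum_eq_zero fun j _ => ?_
  have h2 := map_sum (show N →ₗ[k] k from α (h j))
    (fun i => MulOpposite.op (H i j) • x i) Finset.univ
  rw [hx j, map_zero] at h2
  exact h2.symm

/-- If two functionals take the same values along the `S`-orbits of `n` and `n'`, then so do their
images under an `R`-linear endomorphism of the dual: the pair `(f, -g)` annihilates the
pp-definable subgroup `S (n, n')` of `N²`. -/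
theorem apply_eq_apply_of_forall_end (hN : IsSigmaPureInjective R N) {f g : KDual k N} {n n' : N}
    (h : ∀ s : EndRing R N, f (s n) = g (s n')) (α : KDual k N →ₗ[R] KDual k N) :
    α f n = α g n' := by
  obtain ⟨φ, ψ, r, ⟨y, hy⟩, ⟨z, hz⟩, horb⟩ := exists_pp_orbit_pair hN n n'
  -- the variables are `x`, `x'` and the quantified variables of `φ` and of `ψ`
  let H : (Unit ⊕ Unit) ⊕ (Fin φ.vars ⊕ Fin ψ.vars) → Fin φ.eqs ⊕ Fin ψ.eqs → R :=
    Sum.elim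
      (Sum.elim (fun _ => Sum.elim φ.coeff 0) (fun _ => Sum.elim (-r) ψ.coeff))
      (Sum.elim (fun i => Sum.elim (φ.coeffs i) 0) (fun i => Sum.elim 0 (ψ.coeffs i)))
  let F : (Unit ⊕ Unit) ⊕ (Fin φ.vars ⊕ Fin ψ.vars) → KDual k N :=
    Sum.elim (Sum.elim (fun _ => f) (fun _ => -g)) 0
  have hneg : ∀ (g : KDual k N) (n : N), (-g) n = -g n := fun _ _ => rfl
  have hzero : ∀ n : N, (0 : KDual k N) n = 0 := fun _ => rfl
  have key := sum_apply_eq_zero_of_forall_solution H F (fun x hx => ?_) α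
    (x := Sum.elim (Sum.elim (fun _ => n) (fun _ => n')) (Sum.elim y z)) ?_
  · simp only [F, Fintype.sum_sum_type, Finset.univ_unique, Finset.sum_singleton, Sum.elim_inl,
      Sum.elim_inr, map_neg, hneg, Pi.zero_apply, map_zero, hzero, Finset.sum_const_zero,
      add_zero] at key
    exact add_neg_eq_zero.1 key
  · obtain ⟨s, hs, hs'⟩ := horb (x (Sum.inl (Sum.inl ()))) (x (Sum.inl (Sum.inr ())))
      ⟨fun i => x (Sum.inr (Sum.inl i)), fun j => by
        have := hx (Sum.inl j)
        simp [H, Fintype.sum_sum_type] at this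
        rw [← sub_eq_zero, ← this]
        abel⟩
      ⟨fun i => x (Sum.inr (Sum.inr i)), fun j => by
        have := hx (Sum.inr j)
        simp [H, Fintype.sum_sum_type] at this
        rw [Pi.zero_apply, ← this]⟩
    simp only [F, Fintype.sum_sum_type, Finset.univ_unique, Finset.sum_singleton, Sum.elim_inl,
      Sum.elim_inr, hneg, Pi.zero_apply, hzero, Finset.sum_const_zero, add_zero]
    rw [add_neg_eq_zero]
    have := h s
    rw [hs, hs'] at this
    exact this
  · rintro (j | j)
    · have := hy j
      simp [H, Fintype.sum_sum_type]
      rw [← sub_eq_zero] at this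
      rw [← this]
      abel
    · have := hz j
      simp [H, Fintype.sum_sum_type]
      exact this

/-- A nonzero functional on `N` becomes, after scaling, the residue map `S → k` on some orbit. -/
theorem exists_forall_sub_mem_apply_eq (hN : IsSigmaPureInjective R N)
    (hm : ∀ s : EndRing R N, ∃ c : k, s - algebraMap k (EndRing R N) c ∈ endMaximalIdeal R N)
    {f : KDual k N} (hf : f ≠ 0) :
    ∃ n, ∀ (s : EndRing R N) (c : k), s - algebraMap k (EndRing R N) c ∈ endMaximalIdeal R N →
      f (s n) = c := by
  let f' : N →ₗ[k] k := f
  let K : Submodule (EndRing R N) N := LinearMap.ker (coinduce (S := EndRing R N) f')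
  have hmemK : ∀ {n : N}, n ∈ K ↔ ∀ s : EndRing R N, f' (s n) = 0 := fun {n} =>
    ⟨fun hn s => by
      have := congrArg (fun g : HomDual k (EndRing R N) k => g s) (LinearMap.mem_ker.1 hn)
      exact this, fun hn => LinearMap.ext fun s => hn s⟩
  have hK : K ≠ ⊤ := fun h => hf <| LinearMap.ext fun n =>
    hmemK.1 (h ▸ Submodule.mem_top : n ∈ K) 1
  obtain ⟨n, hn, hmn⟩ := exists_notMem_jacobson_smul_mem hN hK
  have hval : ∀ (s : EndRing R N) (c : k),
      s - algebraMap k (EndRing R N) c ∈ endMaximalIdeal R N → f' (s n) = c * f' n := by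
    intro s c hc
    have h1 : f' ((s - algebraMap k (EndRing R N) c) n) = 0 := hmemK.1 (hmn _ hc) 1
    rw [LinearMap.sub_apply, map_sub, sub_eq_zero] at h1
    rw [h1]
    exact map_smul f' c n
  have hfn : f' n ≠ 0 := fun h0 => hn <| hmemK.2 fun s => by
    obtain ⟨c, hc⟩ := hm s
    rw [hval s c hc, h0, mul_zero]
  refine ⟨(f' n)⁻¹ • n, fun s c hc => ?_⟩
  show f' (s ((f' n)⁻¹ • n)) = c
  have hs : s ((f' n)⁻¹ • n) = (f' n)⁻¹ • s n := LinearMap.map_smul_of_tower s _ n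
  rw [hs, map_smul, hval s c hc, smul_eq_mul]
  field_simp

theorem isIndecomposableModule_kDual [Nontrivial N] (hN : IsSigmaPureInjective R N)
    (hm : ∀ s : EndRing R N, ∃ c : k, s - algebraMap k (EndRing R N) c ∈ endMaximalIdeal R N) :
    IsIndecomposableModule R (KDual k N) := by
  constructor
  · obtain ⟨n, hn⟩ := exists_ne (0 : N)
    obtain ⟨f, hf⟩ := Module.Projective.exists_dual_ne_zero k hn
    refine ⟨⟨(show KDual k N from f), 0, fun h => hf ?_⟩⟩
    exact congrArg (fun g : KDual k N => g n) h
  · intro p q hpq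
    by_contra! hne
    obtain ⟨f, hfp, hf⟩ := (Submodule.ne_bot_iff p).1 hne.1
    obtain ⟨g, hgq, hg⟩ := (Submodule.ne_bot_iff q).1 hne.2
    obtain ⟨n, hn⟩ := exists_forall_sub_mem_apply_eq hN hm hf
    obtain ⟨n', hn'⟩ := exists_forall_sub_mem_apply_eq hN hm hg
    -- `α` is the projection onto `p` along `q`, so that `α f = f` and `α g = 0`
    let α : KDual k N →ₗ[R] KDual k N := p.subtype ∘ₗ p.projectionOnto q hpq
    have h := apply_eq_apply_of_forall_end hN (f := f) (g := g) (n := n) (n' := n') (fun s => by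
      obtain ⟨c, hc⟩ := hm s
      rw [hn s c hc, hn' s c hc]) α
    have hαf : α f = f :=
      congrArg Subtype.val (Submodule.projectionOnto_apply_left hpq ⟨f, hfp⟩)
    have hαg : α g = 0 :=
      congrArg Subtype.val (Submodule.projectionOnto_apply_right hpq ⟨g, hgq⟩)
    rw [hαf, hαg] at h
    have h1 : f n = 1 := hn 1 1 (by rw [map_one, sub_self]; exact zero_mem _)
    rw [h1] at h
    exact one_ne_zero h

theorem IsIndecomposableModule.of_equiv {A : Type u} [Ring A] {M : Type v} {M' : Type w}
    [AddCommGroup M] [Module A M] [AddCommGroup M'] [Module A M'] (e : M' ≃ₗ[A] M)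
    (h : IsIndecomposableModule A M) : IsIndecomposableModule A M' := by
  obtain ⟨h1, h2⟩ := h
  refine ⟨e.toEquiv.nontrivial, fun p q hpq => ?_⟩
  have h3 := (Submodule.orderIsoMapComap e).isCompl hpq
  simpa [Submodule.map_eq_bot_iff] using h2 _ _ h3

end Indecomposable

/-! ### The local dual is the `k`-dual -/

theorem mainTheorem11 (k : Type v) [Field k] (R : Type u) [Ring R] [Algebra k R]
    (N : Type w) [AddCommGroup N] [Module k N] [Module Rᵐᵒᵖ N] [IsScalarTower k Rᵐᵒᵖ N]
    (hN : IsIndecomposableModule Rᵐᵒᵖ N) (hSigma : IsSigmaPureInjective R N)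
    (hk : Function.Bijective (algebraMap k (EndRing R N ⧸ endMaximalIdeal R N))) :
    Nonempty (LocalDual R N ≃ₗ[R] KDual k N) ∧
      IsIndecomposableModule R (LocalDual R N) ∧ IsIndecomposableModule R (KDual k N) := by
  have := hN.1
  have hm : ∀ s : EndRing R N,
      ∃ c : k, s - algebraMap k (EndRing R N) c ∈ endMaximalIdeal R N := fun s => by
    obtain ⟨c, hc⟩ := hk.2 (Ideal.Quotient.mk _ s)
    exact ⟨c, Ideal.Quotient.eq.1 hc.symm⟩
  have hm1 : (1 : EndRing R N) ∉ endMaximalIdeal R N := fun h1 => by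
    refine one_ne_zero (hk.1 (?_ : algebraMap k _ (1 : k) = algebraMap k _ 0))
    rw [map_one, map_zero]
    exact Ideal.Quotient.eq_zero_iff_mem.2 h1
  let S := EndRing R N
  let E := InjectiveHull S (S ⧸ endMaximalIdeal R N)
  let _ : Module k E := Module.compHom E (algebraMap k S)
  have : IsScalarTower k S E := IsScalarTower.of_algebraMap_smul fun _ _ => rfl
  obtain ⟨f, hinj, hsurj⟩ := exists_functional_bijective hm1 hm
    (InjectiveHull.isInjectiveHull S (S ⧸ endMaximalIdeal R N)) (N := N)
    fun K hK => exists_notMem_jacobson_smul_mem hSigma hK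
  let T : LocalDual R N →ₗ[R] KDual k N :=
    { toFun := fun g => show N →ₗ[k] k from f ∘ₗ (show N →ₗ[S] E from g).restrictScalars k
      map_add' := fun g h => LinearMap.ext fun n => map_add f (g n) (h n)
      map_smul' := fun r g => rfl }
  have hT : Function.Bijective T := by
    constructor
    · rw [injective_iff_map_eq_zero]
      intro g hg
      exact hinj g fun n => congrArg (fun g : KDual k N => g n) hg
    · intro h
      obtain ⟨g, hg⟩ := hsurj h
      exact ⟨g, LinearMap.ext hg⟩
  have e := LinearEquiv.ofBijective T hT
  have hd := isIndecomposableModule_kDual hSigma hm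
  exact ⟨⟨e⟩, hd.of_equiv e, hd⟩
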